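/- Let $G$ be a connected Lie group modelled on a Hausdorff locally convex real topological vector space (smooth maps being those of Bastiani calculus: all iterated directional derivatives exist and are jointly continuous). Let $\mathfrak g = T_1G$ be its Lie algebra, with the bracket of left invariant vector fields. Suppose that $G$ is Milnor regular, i.e. every smooth curve $\gamma\colon[0,1]\to\mathfrak g$ has a smooth evolution $\mathrm{Evol}(\gamma)=\eta\colon[0,1]\to G$ with $\eta(0)=1$ and $\eta'(t)=T_1L_{\eta(t)}(\gamma(t))$ for all $t$, and the map $C^\infty([0,1],\mathfrak g)\to G$, $\gamma\mapsto \mathrm{Evol}(\gamma)(1)$, is smooth. Suppose also that $\mathfrak g$ is topologically perfect, i.e. the linear span $[\mathfrak g,\mathfrak g]$ of all brackets is dense in $\mathfrak g$. Then $G$ has no nonzero bi-invariant differential 2-forms: if $\omega$ is a smooth differential 2-form on $G$ with $L_g^*\omega=\omega=R_g^*\omega$ for all $g\in G$, then $\omega=0$. -/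

import Mathlib

open Filter Topology

namespace LCLie

noncomputable section

/-! ### Calculus on locally convex spaces (Bastiani's, also called Keller's `C^∞_c`) -/

section Calculus

variable {E F : Type*} [AddCommGroup E] [Module ℝ E] [TopologicalSpace E]
  [AddCommGroup F] [Module ℝ F] [TopologicalSpace F]

/-- The directional derivative of `f` at `x` in the direction `v` exists and equals `w`. -/
def HasDirDeriv (f : E → F) (x v : E) (w : F) : Prop :=
  Tendsto (fun t : ℝ => t⁻¹ • (f (x + t • v) - f x)) (𝓝[≠] 0) (𝓝 w)

/-- The directional derivative `df(x; v)` (an unspecified value if it does not exist). -/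
def dirDeriv (f : E → F) (x v : E) : F :=
  limUnder (𝓝[≠] (0 : ℝ)) fun t : ℝ => t⁻¹ • (f (x + t • v) - f x)

/-- `f` is smooth on the open set `U`: all the iterated directional derivatives
`d^k f (x; v₁, …, v_k) = (D_{v_k} ⋯ D_{v₁} f)(x)` exist for `x ∈ U`, and each
`d^k f : U × E^k → F` is continuous. (For Hausdorff `F` the family `D` is unique on `U`.) -/
def SmoothOn (f : E → F) (U : Set E) : Prop :=
  ∃ D : (k : ℕ) → E → (Fin k → E) → F,
    (∀ x ∈ U, ∀ v : Fin 0 → E, D 0 x v = f x) ∧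
    (∀ k, ∀ x ∈ U, ∀ (v : Fin k → E) (w : E),
      HasDirDeriv (fun y => D k y v) x w (D (k + 1) x (Fin.snoc v w))) ∧
    ∀ k, ContinuousOn (fun p : E × (Fin k → E) => D k p.1 p.2) (U ×ˢ Set.univ)

end Calculus

/-! ### Manifolds modelled on locally convex spaces -/

section Manifolds

variable (E F : Type*) [AddCommGroup E] [Module ℝ E] [TopologicalSpace E]
  [AddCommGroup F] [Module ℝ F] [TopologicalSpace F]
  {M N : Type*} [TopologicalSpace M] [ChartedSpace E M] [TopologicalSpace N] [ChartedSpace F N]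

/-- All changes of charts are smooth. -/
def SmoothAtlas (M : Type*) [TopologicalSpace M] [ChartedSpace E M] : Prop :=
  ∀ e ∈ atlas E M, ∀ e' ∈ atlas E M,
    SmoothOn (fun x => e' (e.symm x)) {x | x ∈ e.target ∧ e.symm x ∈ e'.source}

/-- Smooth maps between manifolds: continuous, and smooth in charts. -/
def SmoothMap (f : M → N) : Prop :=
  Continuous f ∧ ∀ e ∈ atlas E M, ∀ e' ∈ atlas F N,
    SmoothOn (fun x => e' (f (e.symm x))) {x | x ∈ e.target ∧ f (e.symm x) ∈ e'.source}

/-- The tangent map `T_x f : T_x M → T_{f x} N`. Here and below, `T_x M` is the model space,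
the identification being the one given by the preferred chart `chartAt E x`
(the convention of `TangentSpace` in Mathlib). -/
def tmap (f : M → N) (x : M) (v : E) : F :=
  dirDeriv (fun y => chartAt F (f x) (f ((chartAt E x).symm y))) (chartAt E x x) v

/-- For a chart `e` and `x ∈ e.target`, the tangent map `T_x (e⁻¹) : E → T_{e⁻¹ x} M`. -/
def tchartSymm (e : OpenPartialHomeomorph M E) (x v : E) : E :=
  dirDeriv (fun y => chartAt E (e.symm x) (e.symm y)) x v

/-- For a chart `e` and `p ∈ e.source`, the tangent map `T_p e : T_p M → E`. -/
def tchart (e : OpenPartialHomeomorph M E) (p : M) (v : E) : E :=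
  dirDeriv (fun y => e ((chartAt E p).symm y)) (chartAt E p p) v

/-- The local representative, in the chart `e`, of the vector field `X`, where `X p ∈ T_p M`. -/
def fieldInChart (X : M → E) (e : OpenPartialHomeomorph M E) (x : E) : E :=
  tchart E e (e.symm x) (X (e.symm x))

/-- The Lie bracket `[X, Y]` of vector fields, at `p`: it is computed in the preferred chart at
`p`, as `dY(x; X x) - dX(x; Y x)`. -/
def fieldBracket (X Y : M → E) (p : M) : E :=
  dirDeriv (fieldInChart E Y (chartAt E p)) (chartAt E p p)
      (fieldInChart E X (chartAt E p) (chartAt E p p)) -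
    dirDeriv (fieldInChart E X (chartAt E p)) (chartAt E p p)
      (fieldInChart E Y (chartAt E p) (chartAt E p p))

/-- Differential `k`-forms: an alternating `k`-linear form on every `T_p M`, such that in every
chart `e` the function `(x, v₁, …, v_k) ↦ ω_{e⁻¹ x}(T e⁻¹ v₁, …, T e⁻¹ v_k)` on `e.target × E^k`
is smooth. -/
structure DiffForm (M : Type*) [TopologicalSpace M] [ChartedSpace E M] (k : ℕ) where
  /-- the value at a point -/
  toFun : M → E [⋀^Fin k]→ₗ[ℝ] ℝ
  smooth : ∀ e ∈ atlas E M,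
    SmoothOn (fun p : E × (Fin k → E) =>
      toFun (e.symm p.1) (fun i => tchartSymm E e p.1 (p.2 i))) (e.target ×ˢ Set.univ)

/-- The product manifold `M × N`, modelled on `E × F`, with the products of charts as charts. -/
abbrev prodCharts (M N : Type*) [TopologicalSpace M] [ChartedSpace E M] [TopologicalSpace N]
    [ChartedSpace F N] : ChartedSpace (E × F) (M × N) :=
  prodChartedSpace E M F N

end Manifolds

/-! ### Lie groups -/

section Groups

variable (E : Type*) [AddCommGroup E] [Module ℝ E] [TopologicalSpace E]
  (G : Type*) [Group G] [TopologicalSpace G] [ChartedSpace E G]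

attribute [local instance] prodCharts in
/-- `G` is a Lie group modelled on `E`: a smooth manifold whose group operations are smooth. -/
structure IsLieGroup : Prop where
  smoothAtlas : SmoothAtlas E G
  smooth_mul : SmoothMap (E × E) E (fun p : G × G => p.1 * p.2)
  smooth_inv : SmoothMap E E (fun g : G => g⁻¹)

variable {G}

/-- The left invariant vector field with value `v ∈ T_1 G` at `1`. -/
def leftInvField (v : E) (g : G) : E :=
  tmap E E (fun x : G => g * x) 1 v

variable (G)

/-- The Lie bracket of the Lie algebra `T_1 G`, which is `E` as a topological vector space:
the value at `1` of the bracket of left invariant vector fields. -/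
def bracket (v w : E) : E :=
  fieldBracket E (leftInvField E (G := G) v) (leftInvField E (G := G) w) 1

/-- The Lie algebra of `G` is topologically perfect: the span of all brackets is dense. -/
def TopologicallyPerfect : Prop :=
  closure (Submodule.span ℝ {u : E | ∃ v w : E, u = bracket E G v w} : Set E) = Set.univ

variable {G}

/-- `L_g^* ω = ω = R_g^* ω` for all `g`. -/
def DiffForm.BiInvariant {k : ℕ} (ω : DiffForm E G k) : Prop :=
  ∀ (g x : G) (v : Fin k → E),
    ω.toFun (g * x) (fun i => tmap E E (fun y : G => g * y) x (v i)) = ω.toFun x v ∧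
    ω.toFun (x * g) (fun i => tmap E E (fun y : G => y * g) x (v i)) = ω.toFun x v

end Groups

/-! ### Milnor regularity -/

section Regular

variable (E : Type*) [AddCommGroup E] [Module ℝ E] [TopologicalSpace E]

/-- The curve `c : [0,1] → E` has derivative `w` at `t` (one-sided at the end points). -/
def HasCurveDeriv {E : Type*} [AddCommGroup E] [Module ℝ E] [TopologicalSpace E]
    (c : unitInterval → E) (t : unitInterval) (w : E) : Prop :=
  Tendsto (fun s : unitInterval => ((s : ℝ) - (t : ℝ))⁻¹ • (c s - c t)) (𝓝[≠] t) (𝓝 w)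

/-- The space `C^∞([0,1], E)`. A smooth curve `c` is recorded as the sequence
`(c, c', c'', …)` of its derivatives, in `∏_k C([0,1], E)`; the subspace topology is the usual
one, that of uniform convergence of each derivative. -/
def SmoothCurves [IsTopologicalAddGroup E] [ContinuousSMul ℝ E] :
    Submodule ℝ (ℕ → C(unitInterval, E)) where
  carrier := {c | ∀ k t, HasCurveDeriv (c k) t (c (k + 1) t)}
  add_mem' := by
    intro a b ha hb k t
    refine ((ha k t).add (hb k t)).congr fun s => ?_
    simp only [Pi.add_apply, ContinuousMap.add_apply, ← smul_add]
    congr 1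
    abel
  zero_mem' := by
    intro k t
    simpa [HasCurveDeriv] using tendsto_const_nhds
  smul_mem' := by
    intro r a ha k t
    refine ((ha k t).const_smul r).congr fun s => ?_
    simp only [Pi.smul_apply, ContinuousMap.smul_apply, ← smul_sub]
    rw [smul_comm]

variable {G : Type*} [Group G] [TopologicalSpace G] [ChartedSpace E G]

/-- `η : [0,1] → G` is a smooth curve: it is continuous, and in every chart it has
derivatives of all orders, which are continuous. -/
def IsSmoothCurve (η : unitInterval → G) : Prop :=
  Continuous η ∧ ∀ e ∈ atlas E G, ∃ D : ℕ → unitInterval → E,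
    (∀ t, η t ∈ e.source → D 0 t = e (η t)) ∧
    (∀ k t, η t ∈ e.source → HasCurveDeriv (D k) t (D (k + 1) t)) ∧
    ∀ k, ContinuousOn (D k) {t | η t ∈ e.source}

/-- `η` is the (left) evolution of the curve `γ` in the Lie algebra: a smooth curve with
`η 0 = 1` and `η'(t) = T_1 L_{η t} (γ t)` for all `t ∈ [0,1]`. -/
def IsEvolution (γ : unitInterval → E) (η : unitInterval → G) : Prop :=
  IsSmoothCurve E η ∧ η 0 = 1 ∧
    ∀ t, HasCurveDeriv (fun s => chartAt E (η t) (η s)) t (leftInvField E (γ t) (η t))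

/-- `G` is Milnor regular: every smooth curve `γ : [0,1] → T_1 G` has an evolution `Evol γ`,
and `C^∞([0,1], T_1 G) → G`, `γ ↦ (Evol γ) 1`, is smooth. -/
def MilnorRegular [IsTopologicalAddGroup E] [ContinuousSMul ℝ E]
    (G : Type*) [Group G] [TopologicalSpace G] [ChartedSpace E G] : Prop :=
  ∃ Evol : SmoothCurves E → unitInterval → G,
    (∀ γ : SmoothCurves E, IsEvolution E (γ.1 0) (Evol γ)) ∧
    SmoothMap (SmoothCurves E) E (fun γ => Evol γ 1)

end Regular

end

end LCLie

/-!
A bi-invariant 2-form `ω` is determined by its value `β` at the identity, and `β` is invariant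
under the adjoint action, hence `β([z, v], w) + β(v, [z, w]) = 0`
(`DiffForm.BiInvariant.bracket_add_bracket`). Therefore `f(z, v, w) = β([z, v], w)` is
antisymmetric in its first two arguments and symmetric in its last two. These two symmetries force
`f = 0` (`eq_zero_of_antisymm_of_symm`): `β` vanishes on `[𝔤, 𝔤] × 𝔤`, and on `𝔤 × 𝔤` by density
and continuity. By left invariance `ω = 0`.

The infinitesimal invariance is obtained in the preferred chart at the identity. If `μ` denotes the
multiplication there, then `x ↦ ∂₂μ(x, 1; v)` represents the left invariant vector field of `v`,
and `x ↦ ∂₁μ(1, x; v)` the right invariant one. The local representative of `ω` is constant along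
both kinds of frames; the derivatives of these two facts in direction `z` differ by the
bracket terms, because `[v, w] = ∂₁∂₂μ(v, w) - ∂₁∂₂μ(w, v)` (`IsLieGroup.bracket_eq`).
This needs the chain rule, additivity of the derivative, and Schwarz's theorem in Bastiani's
calculus. All of them come from the mean value theorem `slope_mem_of_hasDirDeriv` through the strict
differentiability `SmoothOn.tendsto_slope`.
-/

namespace LCLie

/-! ### Calculus on locally convex spaces -/

section

variable {E F : Type*} [AddCommGroup E] [Module ℝ E]
  [AddCommGroup F] [Module ℝ F] [TopologicalSpace F]

theorem HasDirDeriv.dirDeriv_eq [T2Space F] {f : E → F} {x v : E} {w : F}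
    (h : HasDirDeriv f x v w) : dirDeriv f x v = w :=
  h.limUnder_eq

theorem HasDirDeriv.const_smul [ContinuousConstSMul ℝ F] {f : E → F} {x v : E} {w : F}
    (h : HasDirDeriv f x v w) (r : ℝ) : HasDirDeriv f x (r • v) (r • w) := by
  rcases eq_or_ne r 0 with rfl | hr
  · simpa [HasDirDeriv] using tendsto_const_nhds
  have h1 : Tendsto (fun t : ℝ => t * r) (𝓝[≠] 0) (𝓝[≠] 0) := by
    refine tendsto_nhdsWithin_iff.2 ⟨?_, ?_⟩
    · have : Continuous fun t : ℝ => t * r := by fun_prop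
      simpa using (this.tendsto 0).mono_left nhdsWithin_le_nhds
    · filter_upwards [self_mem_nhdsWithin] with t ht
      exact mul_ne_zero ht hr
  refine ((h.comp h1).const_smul r).congr fun t => ?_
  simp only [Function.comp_apply, smul_smul, mul_inv]
  congr 1
  field_simp

theorem HasDirDeriv.hasDerivAt_clm {f : E → F} {y w : E} {s : ℝ} {a : F}
    (h : HasDirDeriv f (y + s • w) w a) (l : F →L[ℝ] ℝ) :
    HasDerivAt (fun r : ℝ => l (f (y + r • w))) (l a) s := by
  rw [hasDerivAt_iff_tendsto_slope_zero]
  refine ((l.continuous.tendsto a).comp h).congr fun t => ?_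
  simp only [Function.comp_apply, map_smul, map_sub, add_smul, add_assoc]

theorem HasDirDeriv.clm_comp {f : E → F} {x v : E} {a : F}
    (h : HasDirDeriv f x v a) (l : F →L[ℝ] ℝ) : HasDirDeriv (fun y => l (f y)) x v (l a) := by
  refine ((l.continuous.tendsto a).comp h).congr fun t => ?_
  simp

/-- The mean value theorem: a difference quotient of `f` lies in every closed convex set that
contains the directional derivatives along the segment. By Hahn–Banach it reduces to real-valued
functions, so no completeness of `F` is needed. -/
theorem slope_mem_of_hasDirDeriv [IsTopologicalAddGroup F] [ContinuousSMul ℝ F]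
    [LocallyConvexSpace ℝ F] {f : E → F} {W : Set F} (hW : Convex ℝ W) (hWc : IsClosed W)
    {y w : E} {t : ℝ} (ht : t ≠ 0) {d : E → F}
    (hd : ∀ s ∈ Set.Icc (0 : ℝ) 1, HasDirDeriv f (y + s • t • w) w (d (y + s • t • w)))
    (hdW : ∀ s ∈ Set.Icc (0 : ℝ) 1, d (y + s • t • w) ∈ W) :
    t⁻¹ • (f (y + t • w) - f y) ∈ W := by
  by_contra hcon
  obtain ⟨l, u, hlu, hul⟩ := geometric_hahn_banach_closed_point hW hWc hcon
  have hder : ∀ s ∈ Set.Icc (0 : ℝ) 1, HasDerivAt (fun r : ℝ => l (f (y + r • t • w)))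
      (t * l (d (y + s • t • w))) s := by
    intro s hs
    simpa using ((hd s hs).const_smul t).hasDerivAt_clm l
  obtain ⟨c, hc, hc'⟩ := exists_hasDerivAt_eq_slope (fun r : ℝ => l (f (y + r • t • w)))
    (fun s => t * l (d (y + s • t • w))) zero_lt_one
    (fun s hs => (hder s hs).continuousAt.continuousWithinAt)
    (fun s hs => hder s (Set.Ioo_subset_Icc_self hs))
  have h1 := hlu _ (hdW c (Set.Ioo_subset_Icc_self hc))
  simp only [one_smul, zero_smul, add_zero, sub_zero, div_one] at hc'
  rw [map_smul, map_sub, ← hc', smul_eq_mul, inv_mul_cancel_left₀ ht] at hul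
  exact lt_asymm h1 hul

theorem HasDirDeriv.left {f : E × E → F} {x y v : E} {w : F}
    (h : HasDirDeriv f (x, y) (v, 0) w) : HasDirDeriv (fun z => f (z, y)) x v w := by
  simpa [HasDirDeriv] using h

theorem HasDirDeriv.right {f : E × E → F} {x y v : E} {w : F}
    (h : HasDirDeriv f (x, y) (0, v) w) : HasDirDeriv (fun z => f (x, z)) y v w := by
  simpa [HasDirDeriv] using h

variable [TopologicalSpace E]

theorem SmoothOn.continuousOn {f : E → F} {U : Set E} (hf : SmoothOn f U) : ContinuousOn f U := by
  obtain ⟨D, h0, -, h⟩ := hf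
  have hc : Continuous fun x : E => (x, (Fin.elim0 : Fin 0 → E)) := by fun_prop
  exact ((h 0).comp hc.continuousOn fun x hx => ⟨hx, trivial⟩).congr fun x hx => (h0 x hx _).symm

theorem SmoothOn.clm_comp {f : E → F} {U : Set E} (hf : SmoothOn f U) (l : F →L[ℝ] ℝ) :
    SmoothOn (fun y => l (f y)) U := by
  obtain ⟨D, h0, h1, h2⟩ := hf
  exact ⟨fun k x v => l (D k x v), fun x hx v => congrArg l (h0 x hx v),
    fun k x hx v w => (h1 k x hx v w).clm_comp l, fun k => l.continuous.comp_continuousOn (h2 k)⟩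

theorem HasDirDeriv.congr_of_eventuallyEq [ContinuousAdd E] [ContinuousSMul ℝ E]
    {f g : E → F} {x v : E} {w : F} (h : HasDirDeriv f x v w) (hfg : f =ᶠ[𝓝 x] g) :
    HasDirDeriv g x v w := by
  have h1 : Tendsto (fun t : ℝ => x + t • v) (𝓝[≠] 0) (𝓝 x) := by
    have : Continuous fun t : ℝ => x + t • v := by fun_prop
    simpa using (this.tendsto 0).mono_left nhdsWithin_le_nhds
  refine Tendsto.congr' ?_ h
  filter_upwards [h1.eventually hfg] with t ht
  rw [ht, hfg.self_of_nhds]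

variable [IsTopologicalAddGroup E] [ContinuousSMul ℝ E]
variable {f : E → F} {U : Set E}

/-- The family in the definition of smoothness starts with `dirDeriv f`, which therefore inherits
existence and continuity. -/
theorem SmoothOn.exists_family (hU : IsOpen U) (hf : SmoothOn f U) [T2Space F] :
    ∃ D : (k : ℕ) → E → (Fin k → E) → F,
    (∀ x ∈ U, ∀ v : Fin 1 → E, D 1 x v = dirDeriv f x (v 0)) ∧
    (∀ x ∈ U, ∀ v : E, HasDirDeriv f x v (dirDeriv f x v)) ∧
    (∀ k, ∀ x ∈ U, ∀ (v : Fin k → E) (w : E),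
      HasDirDeriv (fun y => D k y v) x w (D (k + 1) x (Fin.snoc v w))) ∧
    ∀ k, ContinuousOn (fun p : E × (Fin k → E) => D k p.1 p.2) (U ×ˢ Set.univ) := by
  obtain ⟨D, h0, h1, h2⟩ := hf
  have key : ∀ x ∈ U, ∀ v : Fin 1 → E, HasDirDeriv f x (v 0) (D 1 x v) := by
    intro x hx v
    have h := (h1 0 x hx Fin.elim0 (v 0)).congr_of_eventuallyEq (g := f) <| by
      filter_upwards [hU.mem_nhds hx] with y hy using h0 y hy _
    have hv : (Fin.snoc Fin.elim0 (v 0) : Fin 1 → E) = v := by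
      funext i
      fin_cases i
      rfl
    rwa [hv] at h
  refine ⟨D, fun x hx v => ((key x hx v).dirDeriv_eq).symm, fun x hx v => ?_, h1, h2⟩
  have h := key x hx fun _ => v
  rwa [h.dirDeriv_eq]

variable [T2Space F]

theorem SmoothOn.hasDirDeriv (hU : IsOpen U) (hf : SmoothOn f U) {x : E} (hx : x ∈ U) (v : E) :
    HasDirDeriv f x v (dirDeriv f x v) := by
  obtain ⟨D, -, h, -⟩ := hf.exists_family hU
  exact h x hx v

theorem SmoothOn.continuousOn_dirDeriv (hU : IsOpen U) (hf : SmoothOn f U) :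
    ContinuousOn (fun p : E × E => dirDeriv f p.1 p.2) (U ×ˢ Set.univ) := by
  obtain ⟨D, h1, -, -, h⟩ := hf.exists_family hU
  have hc : Continuous fun p : E × E => (p.1, fun _ : Fin 1 => p.2) := by fun_prop
  refine ((h 1).comp hc.continuousOn fun p hp => ⟨hp.1, trivial⟩).congr fun p hp => ?_
  exact (h1 p.1 hp.1 fun _ => p.2).symm

theorem SmoothOn.dirDeriv (hU : IsOpen U) (hf : SmoothOn f U) (v : E) :
    SmoothOn (fun y => dirDeriv f y v) U := by
  obtain ⟨D, h1, -, h2, h3⟩ := hf.exists_family hU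
  refine ⟨fun k x u => D (k + 1) x (Fin.cons v u), fun x hx u => ?_, fun k x hx u w => ?_,
    fun k => ?_⟩
  · simpa using h1 x hx (Fin.cons v u)
  · have := h2 (k + 1) x hx (Fin.cons v u) w
    rwa [← Fin.cons_snoc_eq_snoc_cons] at this
  · have hc : Continuous fun p : E × (Fin k → E) =>
        (p.1, (Fin.cons v p.2 : Fin (k + 1) → E)) := by
      refine continuous_fst.prodMk (continuous_pi fun i => ?_)
      refine Fin.cases ?_ (fun j => ?_) i
      · simpa using continuous_const
      · exact (continuous_apply j).comp continuous_snd
    exact (h3 (k + 1)).comp hc.continuousOn fun p hp => ⟨hp.1, trivial⟩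

section MeanValue

variable [IsTopologicalAddGroup F] [ContinuousSMul ℝ F] [LocallyConvexSpace ℝ F]

/-- A Bastiani-smooth map is strictly differentiable, in the sense that its difference quotients
converge even when base point and direction vary. The chain rule, the linearity of the
derivative and the symmetry of second derivatives all follow from this. -/
theorem SmoothOn.tendsto_slope (hU : IsOpen U) (hf : SmoothOn f U) {x v : E} (hx : x ∈ U)
    {α : Type*} {l : Filter α} {y w : α → E} {t : α → ℝ} (hy : Tendsto y l (𝓝 x))
    (hw : Tendsto w l (𝓝 v)) (ht : Tendsto t l (𝓝[≠] 0)) :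
    Tendsto (fun a => (t a)⁻¹ • (f (y a + t a • w a) - f (y a))) l
      (𝓝 (LCLie.dirDeriv f x v)) := by
  intro N hN
  obtain ⟨V, hV, hVc, hVN⟩ := exists_mem_nhds_isClosed_subset hN
  obtain ⟨C, ⟨hC, hCx⟩, hCV⟩ :=
    (LocallyConvexSpace.convex_basis (𝕜 := ℝ) (LCLie.dirDeriv f x v)).mem_iff.1 hV
  have hWN : closure C ⊆ N := (closure_minimal hCV hVc).trans hVN
  have hgood : ∀ᶠ p : E × E in 𝓝 (x, v), p.1 ∈ U ∧ LCLie.dirDeriv f p.1 p.2 ∈ closure C := by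
    have hmem : U ×ˢ (Set.univ : Set E) ∈ 𝓝 (x, v) :=
      prod_mem_nhds (hU.mem_nhds hx) univ_mem
    filter_upwards [hmem, ((hf.continuousOn_dirDeriv hU).continuousAt hmem).eventually
      (mem_of_superset hC subset_closure)] with p hp hp'
    exact ⟨hp.1, hp'⟩
  have hseg : ∀ᶠ q : E × ℝ × E in 𝓝 (x, 0, v), ∀ s ∈ Set.Icc (0 : ℝ) 1,
      q.1 + s • q.2.1 • q.2.2 ∈ U ∧
        LCLie.dirDeriv f (q.1 + s • q.2.1 • q.2.2) q.2.2 ∈ closure C := by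
    refine isCompact_Icc.eventually_forall_of_forall_eventually fun s _ => ?_
    have hc : Continuous fun z : (E × ℝ × E) × ℝ =>
        (z.1.1 + z.2 • z.1.2.1 • z.1.2.2, z.1.2.2) := by fun_prop
    have := hc.tendsto ((x, 0, v), s)
    simp only [zero_smul, smul_zero, add_zero] at this
    exact this.eventually hgood
  have hq : Tendsto (fun a => (y a, t a, w a)) l (𝓝 (x, 0, v)) :=
    hy.prodMk_nhds ((ht.mono_right nhdsWithin_le_nhds).prodMk_nhds hw)
  refine mem_map.2 ?_
  filter_upwards [hq.eventually hseg, ht.eventually self_mem_nhdsWithin] with a ha hta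
  exact hWN (slope_mem_of_hasDirDeriv hCx.closure isClosed_closure hta
    (d := fun z => LCLie.dirDeriv f z (w a))
    (fun s hs => hf.hasDirDeriv hU (ha s hs).1 _) fun s hs => (ha s hs).2)

/-- The chain rule for a map along a curve. -/
theorem SmoothOn.tendsto_comp_curve (hU : IsOpen U) (hf : SmoothOn f U) {c : ℝ → E} {v : E}
    (hx : c 0 ∈ U) (hc : Tendsto (fun t : ℝ => t⁻¹ • (c t - c 0)) (𝓝[≠] 0) (𝓝 v)) :
    Tendsto (fun t : ℝ => t⁻¹ • (f (c t) - f (c 0))) (𝓝[≠] 0)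
      (𝓝 (LCLie.dirDeriv f (c 0) v)) := by
  refine (hf.tendsto_slope hU hx tendsto_const_nhds hc tendsto_id).congr' ?_
  filter_upwards [self_mem_nhdsWithin] with t ht
  simp [smul_inv_smul₀ (show t ≠ 0 from ht)]

theorem SmoothOn.dirDeriv_add (hU : IsOpen U) (hf : SmoothOn f U) {x : E} (hx : x ∈ U) (v w : E) :
    LCLie.dirDeriv f x (v + w) = LCLie.dirDeriv f x v + LCLie.dirDeriv f x w := by
  have hy : Tendsto (fun t : ℝ => x + t • w) (𝓝[≠] 0) (𝓝 x) := by
    have : Continuous fun t : ℝ => x + t • w := by fun_prop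
    simpa using (this.tendsto 0).mono_left nhdsWithin_le_nhds
  have h1 := hf.tendsto_slope hU hx hy (tendsto_const_nhds (x := v)) tendsto_id
  refine HasDirDeriv.dirDeriv_eq ((h1.add (hf.hasDirDeriv hU hx w)).congr fun t => ?_)
  simp only [id, ← smul_add, sub_add_sub_cancel]
  rw [add_assoc, add_comm (t • w), ← smul_add]

end MeanValue

/-- The second difference quotients of a real-valued smooth function converge to the iterated
derivative. The quotient is symmetric in the two directions. -/
theorem SmoothOn.tendsto_second_difference {f : E → ℝ} (hU : IsOpen U) (hf : SmoothOn f U)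
    {x : E} (hx : x ∈ U) (v w : E) :
    Tendsto (fun t : ℝ => t⁻¹ * (t⁻¹ * (f (x + t • v + t • w) - f (x + t • v) - f (x + t • w)
      + f x))) (𝓝[≠] 0) (𝓝 (LCLie.dirDeriv (fun y => LCLie.dirDeriv f y v) x w)) := by
  have hev : ∀ᶠ t : ℝ in 𝓝[≠] 0, ∃ s ∈ Set.Icc (0 : ℝ) 1,
      t⁻¹ * (f (x + t • v + t • w) - f (x + t • v) - f (x + t • w) + f x) =
        LCLie.dirDeriv f (x + s • t • v + t • w) v - LCLie.dirDeriv f (x + s • t • v) v := by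
    have hseg : ∀ᶠ t : ℝ in 𝓝 0, ∀ s ∈ Set.Icc (0 : ℝ) 1,
        x + s • t • v + t • w ∈ U ∧ x + s • t • v ∈ U := by
      refine isCompact_Icc.eventually_forall_of_forall_eventually fun s _ => ?_
      have h1 : Continuous fun z : ℝ × ℝ => x + z.2 • z.1 • v + z.1 • w := by fun_prop
      have h2 : Continuous fun z : ℝ × ℝ => x + z.2 • z.1 • v := by fun_prop
      have h1' := h1.tendsto (0, s)
      have h2' := h2.tendsto (0, s)
      simp only [zero_smul, smul_zero, add_zero] at h1' h2'
      exact (h1'.eventually (hU.mem_nhds hx)).and (h2'.eventually (hU.mem_nhds hx))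
    filter_upwards [hseg.filter_mono nhdsWithin_le_nhds, self_mem_nhdsWithin] with t ht ht0
    have hder : ∀ s ∈ Set.Icc (0 : ℝ) 1,
        HasDerivAt (fun r : ℝ => f (x + t • w + r • t • v) - f (x + r • t • v))
          (t * (LCLie.dirDeriv f (x + s • t • v + t • w) v
            - LCLie.dirDeriv f (x + s • t • v) v)) s := by
      intro s hs
      have e : x + s • t • v + t • w = x + t • w + s • t • v := by abel
      have h1 := ((hf.hasDirDeriv hU (ht s hs).1 v).const_smul t)
      rw [e] at h1
      have h2 := ((hf.hasDirDeriv hU (ht s hs).2 v).const_smul t)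
      have := (h1.hasDerivAt_clm (ContinuousLinearMap.id ℝ ℝ)).sub
        (h2.hasDerivAt_clm (ContinuousLinearMap.id ℝ ℝ))
      rw [e, mul_sub]
      exact this
    -- One difference is replaced by a derivative at an intermediate point; strict
    -- differentiability of that derivative then handles the other.
    obtain ⟨c, hc, hc'⟩ := exists_hasDerivAt_eq_slope _ _ zero_lt_one
      (fun s hs => (hder s hs).continuousAt.continuousWithinAt)
      (fun s hs => hder s (Set.Ioo_subset_Icc_self hs))
    refine ⟨c, Set.Ioo_subset_Icc_self hc, ?_⟩
    rw [inv_mul_eq_iff_eq_mul₀ ht0, hc']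
    simp only [one_smul, zero_smul, add_zero, sub_zero, div_one]
    rw [add_right_comm x (t • w)]
    ring
  choose! s hs hs' using fun (t : ℝ) (h : ∃ s ∈ Set.Icc (0 : ℝ) 1,
    t⁻¹ * (f (x + t • v + t • w) - f (x + t • v) - f (x + t • w) + f x) =
      LCLie.dirDeriv f (x + s • t • v + t • w) v - LCLie.dirDeriv f (x + s • t • v) v) => h
  have hst : Tendsto (fun t => s t * t) (𝓝[≠] 0) (𝓝 0) := by
    refine squeeze_zero_norm' (a := fun t : ℝ => ‖t‖) ?_ ?_
    · filter_upwards [hev] with t ht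
      have := hs t ht
      rw [norm_mul, Real.norm_of_nonneg this.1]
      exact mul_le_of_le_one_left (norm_nonneg t) this.2
    · exact (tendsto_norm_zero).mono_left nhdsWithin_le_nhds
  have hy : Tendsto (fun t => x + s t • t • v) (𝓝[≠] 0) (𝓝 x) := by
    have := (hst.smul_const v).const_add x
    simpa [mul_smul] using this
  refine ((hf.dirDeriv hU v).tendsto_slope hU hx hy (tendsto_const_nhds (x := w))
    tendsto_id).congr' ?_
  filter_upwards [hev] with t ht
  rw [hs' t ht]
  rfl

/-- Schwarz's theorem. Continuous functionals separate the points of `F`, so it suffices to treat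
real-valued functions. -/
theorem SmoothOn.dirDeriv_comm [IsTopologicalAddGroup F] [ContinuousSMul ℝ F]
    [LocallyConvexSpace ℝ F] (hU : IsOpen U) (hf : SmoothOn f U) {x : E} (hx : x ∈ U) (v w : E) :
    LCLie.dirDeriv (fun y => LCLie.dirDeriv f y v) x w =
      LCLie.dirDeriv (fun y => LCLie.dirDeriv f y w) x v := by
  by_contra hne
  obtain ⟨l, hl⟩ := SeparatingDual.exists_separating_of_ne (R := ℝ) hne
  have key : ∀ v w : E, l (LCLie.dirDeriv (fun y => LCLie.dirDeriv f y v) x w) =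
      LCLie.dirDeriv (fun y => LCLie.dirDeriv (fun z => l (f z)) y v) x w := by
    intro v w
    refine (HasDirDeriv.dirDeriv_eq ?_).symm
    refine (((hf.dirDeriv hU v).hasDirDeriv hU hx w).clm_comp l).congr_of_eventuallyEq ?_
    filter_upwards [hU.mem_nhds hx] with y hy
    exact ((hf.hasDirDeriv hU hy v).clm_comp l).dirDeriv_eq.symm
  refine hl ?_
  rw [key, key]
  refine tendsto_nhds_unique ((hf.clm_comp l).tendsto_second_difference hU hx v w)
    (((hf.clm_comp l).tendsto_second_difference hU hx w v).congr fun t => ?_)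
  rw [add_right_comm x (t • w)]
  ring

end

/-! ### Changes of charts -/

section Charts

variable {E : Type*} [AddCommGroup E] [Module ℝ E] [TopologicalSpace E]
  [IsTopologicalAddGroup E] [ContinuousSMul ℝ E] [LocallyConvexSpace ℝ E] [T2Space E]
  {M : Type*} [TopologicalSpace M] [ChartedSpace E M]
  {V : Type*} [AddCommGroup V] [Module ℝ V]

/-- Reading an `M`-valued map in another chart changes its directional derivative by the
derivative of the change of charts. -/
theorem SmoothAtlas.hasDirDeriv_change (hM : SmoothAtlas E M) {e e' : OpenPartialHomeomorph M E}
    (he : e ∈ atlas E M) (he' : e' ∈ atlas E M) {g : V → M} {x v : V} {w : E}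
    (hg : Tendsto (fun t : ℝ => g (x + t • v)) (𝓝 0) (𝓝 (g x)))
    (hx : g x ∈ e.source) (hx' : g x ∈ e'.source) (h : HasDirDeriv (fun y => e (g y)) x v w) :
    HasDirDeriv (fun y => e' (g y)) x v (dirDeriv (fun y => e' (e.symm y)) (e (g x)) w) := by
  have hU : IsOpen {y | y ∈ e.target ∧ e.symm y ∈ e'.source} := (e.symm.trans e').open_source
  have hmem : e (g x) ∈ {y | y ∈ e.target ∧ e.symm y ∈ e'.source} :=
    ⟨e.map_source hx, by rwa [e.left_inv hx]⟩
  have := (hM e he e' he').tendsto_comp_curve hU (c := fun t : ℝ => e (g (x + t • v))) (v := w)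
    (by simpa using hmem) (by simpa [HasDirDeriv] using h)
  simp only [zero_smul, add_zero, e.left_inv hx] at this
  refine this.congr' ?_
  filter_upwards [(hg.eventually (e.open_source.mem_nhds hx)).filter_mono nhdsWithin_le_nhds]
    with t ht
  rw [e.left_inv ht]

end Charts

/-! ### The multiplication in a chart at the identity -/

section Group

variable {E : Type*} [TopologicalSpace E] {G : Type*} [Group G] [TopologicalSpace G]

/-- The multiplication of `G`, read in the chart `e`. -/
def chartMul (e : OpenPartialHomeomorph G E) (p : E × E) : E :=
  e (e.symm p.1 * e.symm p.2)

/-- The set on which `chartMul e` has its intended meaning. -/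
def chartMulDomain (e : OpenPartialHomeomorph G E) : Set (E × E) :=
  {p | p ∈ e.target ×ˢ e.target ∧ e.symm p.1 * e.symm p.2 ∈ e.source}

variable [ChartedSpace E G]

theorem mem_chartMulDomain_right {x : E} (hx : x ∈ (chartAt E (1 : G)).target) :
    (x, chartAt E (1 : G) 1) ∈ chartMulDomain (chartAt E (1 : G)) := by
  refine ⟨⟨hx, mem_chart_target E 1⟩, ?_⟩
  simpa using (chartAt E (1 : G)).map_target hx

theorem mem_chartMulDomain_left {x : E} (hx : x ∈ (chartAt E (1 : G)).target) :
    (chartAt E (1 : G) 1, x) ∈ chartMulDomain (chartAt E (1 : G)) := by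
  refine ⟨⟨mem_chart_target E 1, hx⟩, ?_⟩
  simpa using (chartAt E (1 : G)).map_target hx

variable [AddCommGroup E] [Module ℝ E]

theorem IsLieGroup.isOpen_chartMulDomain (hG : IsLieGroup E G) (e : OpenPartialHomeomorph G E) :
    IsOpen (chartMulDomain e) := by
  have h1 : ContinuousOn (fun p : E × E => e.symm p.1 * e.symm p.2) (e.target ×ˢ e.target) :=
    hG.smooth_mul.1.comp_continuousOn (f := fun p : E × E => (e.symm p.1, e.symm p.2))
      (e.continuousOn_symm.prodMap e.continuousOn_symm)
  exact h1.isOpen_inter_preimage (e.open_target.prod e.open_target) e.open_source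

theorem IsLieGroup.smoothOn_chartMul (hG : IsLieGroup E G) {e : OpenPartialHomeomorph G E}
    (he : e ∈ atlas E G) : SmoothOn (chartMul e) (chartMulDomain e) :=
  hG.smooth_mul.2 (e.prod e) (Set.mem_image2_of_mem he he) e he

variable [IsTopologicalAddGroup E] [ContinuousSMul ℝ E]

theorem IsLieGroup.tendsto_mul_symm (hG : IsLieGroup E G) (e : OpenPartialHomeomorph G E)
    {p : E × E} (hp : p ∈ e.target ×ˢ e.target) (u : E × E) :
    Tendsto (fun t : ℝ => e.symm (p + t • u).1 * e.symm (p + t • u).2) (𝓝 0)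
      (𝓝 (e.symm p.1 * e.symm p.2)) := by
  have h1 : ContinuousAt (fun q : E × E => e.symm q.1 * e.symm q.2) p :=
    hG.smooth_mul.1.continuousAt.comp (f := fun q : E × E => (e.symm q.1, e.symm q.2))
      ((e.continuousAt_symm hp.1).prodMap (e.continuousAt_symm hp.2))
  have h2 : Continuous fun t : ℝ => p + t • u := by fun_prop
  have h3 := h2.tendsto 0
  rw [zero_smul, add_zero] at h3
  exact h1.tendsto.comp h3

variable [T2Space E]

theorem dirDeriv_eq_of_eventually_eq {f : E → E} {x : E} (h : ∀ᶠ y in 𝓝 x, f y = y) (v : E) :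
    dirDeriv f x v = v := by
  refine HasDirDeriv.dirDeriv_eq
    (HasDirDeriv.congr_of_eventuallyEq (f := id) ?_ (h.mono fun _ hy => hy.symm))
  refine tendsto_const_nhds.congr' ?_
  filter_upwards [self_mem_nhdsWithin] with t ht
  simp [inv_smul_smul₀ (show t ≠ 0 from ht)]

theorem IsLieGroup.dirDeriv_chartMul_right (hG : IsLieGroup E G) (v : E) :
    dirDeriv (chartMul (chartAt E (1 : G))) (chartAt E (1 : G) 1, chartAt E (1 : G) 1) (0, v)
      = v := by
  have h := ((hG.smoothOn_chartMul (chart_mem_atlas E 1)).hasDirDeriv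
    (hG.isOpen_chartMulDomain _) (mem_chartMulDomain_right (mem_chart_target E 1)) (0, v)).right
  rw [← h.dirDeriv_eq]
  refine dirDeriv_eq_of_eventually_eq ?_ v
  simpa [chartMul] using (chartAt E (1 : G)).eventually_right_inverse (mem_chart_target E 1)

theorem IsLieGroup.dirDeriv_chartMul_left (hG : IsLieGroup E G) (v : E) :
    dirDeriv (chartMul (chartAt E (1 : G))) (chartAt E (1 : G) 1, chartAt E (1 : G) 1) (v, 0)
      = v := by
  have h := ((hG.smoothOn_chartMul (chart_mem_atlas E 1)).hasDirDeriv
    (hG.isOpen_chartMulDomain _) (mem_chartMulDomain_right (mem_chart_target E 1)) (v, 0)).left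
  rw [← h.dirDeriv_eq]
  refine dirDeriv_eq_of_eventually_eq ?_ v
  simpa [chartMul] using (chartAt E (1 : G)).eventually_right_inverse (mem_chart_target E 1)

variable (G) in
/-- The mixed second derivative `∂₁∂₂μ(z, v)`, at the identity, of the multiplication `μ` read in
the preferred chart there: differentiate in the second factor along `v`, then in the first factor
along `z`. -/
noncomputable def mixedDeriv (z v : E) : E :=
  dirDeriv (fun q => dirDeriv (chartMul (chartAt E (1 : G))) q (0, v))
    (chartAt E (1 : G) 1, chartAt E (1 : G) 1) (z, 0)

theorem IsLieGroup.hasDirDeriv_left_translation (hG : IsLieGroup E G) (z v : E) :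
    HasDirDeriv (fun x => dirDeriv (chartMul (chartAt E (1 : G))) (x, chartAt E (1 : G) 1) (0, v))
      (chartAt E (1 : G) 1) z (mixedDeriv G z v) :=
  (((hG.smoothOn_chartMul (chart_mem_atlas E 1)).dirDeriv (hG.isOpen_chartMulDomain _)
    (0, v)).hasDirDeriv (hG.isOpen_chartMulDomain _)
    (mem_chartMulDomain_right (mem_chart_target E 1)) (z, 0)).left

variable [LocallyConvexSpace ℝ E]

/-- The multiplication read in the preferred chart at the product `g`, which is the chart that
`tmap` refers to, is differentiated by transporting the derivative of `chartMul e`. -/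
theorem IsLieGroup.hasDirDeriv_chartAt_mul (hG : IsLieGroup E G) {e : OpenPartialHomeomorph G E}
    (he : e ∈ atlas E G) {p : E × E} (hp : p ∈ chartMulDomain e) (u : E × E) {g : G}
    (hg : e.symm p.1 * e.symm p.2 = g) :
    HasDirDeriv (fun q : E × E => chartAt E g (e.symm q.1 * e.symm q.2)) p u
      (tchartSymm E e (e g) (dirDeriv (chartMul e) p u)) := by
  subst hg
  have h := hG.smoothAtlas.hasDirDeriv_change he (chart_mem_atlas E _)
    (g := fun q : E × E => e.symm q.1 * e.symm q.2) (hG.tendsto_mul_symm e hp.1 u) hp.2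
    (mem_chart_source E _)
    ((hG.smoothOn_chartMul he).hasDirDeriv (hG.isOpen_chartMulDomain e) hp u)
  unfold tchartSymm
  rwa [e.left_inv hp.2]

theorem IsLieGroup.tchart_tchartSymm_chartMul (hG : IsLieGroup E G) {e : OpenPartialHomeomorph G E}
    (he : e ∈ atlas E G) {p : E × E} (hp : p ∈ chartMulDomain e) (u : E × E) {g : G}
    (hg : e.symm p.1 * e.symm p.2 = g) :
    tchart E e g (tchartSymm E e (e g) (dirDeriv (chartMul e) p u)) =
      dirDeriv (chartMul e) p u := by
  have h := hG.hasDirDeriv_chartAt_mul he hp u hg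
  subst hg
  exact (hG.smoothAtlas.hasDirDeriv_change (chart_mem_atlas E _) he
    (g := fun q : E × E => e.symm q.1 * e.symm q.2) (hG.tendsto_mul_symm e hp.1 u)
    (mem_chart_source E _) hp.2 h).dirDeriv_eq.symm

theorem IsLieGroup.tmap_mul_left (hG : IsLieGroup E G) {x : E}
    (hx : x ∈ (chartAt E (1 : G)).target) (v : E) :
    tmap E E (fun y : G => (chartAt E (1 : G)).symm x * y) 1 v =
      tchartSymm E (chartAt E (1 : G)) x
        (dirDeriv (chartMul (chartAt E (1 : G))) (x, chartAt E (1 : G) 1) (0, v)) := by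
  have h := (hG.hasDirDeriv_chartAt_mul (chart_mem_atlas E 1) (mem_chartMulDomain_right hx) (0, v)
    (g := (chartAt E (1 : G)).symm x) (by simp)).right.dirDeriv_eq
  rw [(chartAt E (1 : G)).right_inv hx] at h
  rw [← h]
  simp only [tmap, mul_one]

theorem IsLieGroup.tmap_mul_right (hG : IsLieGroup E G) {x : E}
    (hx : x ∈ (chartAt E (1 : G)).target) (v : E) :
    tmap E E (fun y : G => y * (chartAt E (1 : G)).symm x) 1 v =
      tchartSymm E (chartAt E (1 : G)) x
        (dirDeriv (chartMul (chartAt E (1 : G))) (chartAt E (1 : G) 1, x) (v, 0)) := by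
  have h := (hG.hasDirDeriv_chartAt_mul (chart_mem_atlas E 1) (mem_chartMulDomain_left hx) (v, 0)
    (g := (chartAt E (1 : G)).symm x) (by simp)).left.dirDeriv_eq
  rw [(chartAt E (1 : G)).right_inv hx] at h
  rw [← h]
  simp only [tmap, one_mul]

/-- The local representative of the left invariant field of `v` is `x ↦ ∂₂μ(x, 1; v)`. -/
theorem IsLieGroup.fieldInChart_leftInvField (hG : IsLieGroup E G) {x : E}
    (hx : x ∈ (chartAt E (1 : G)).target) (v : E) :
    fieldInChart E (leftInvField E (G := G) v) (chartAt E (1 : G)) x =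
      dirDeriv (chartMul (chartAt E (1 : G))) (x, chartAt E (1 : G) 1) (0, v) := by
  have h := hG.tchart_tchartSymm_chartMul (chart_mem_atlas E 1) (mem_chartMulDomain_right hx)
    (0, v) (g := (chartAt E (1 : G)).symm x) (by simp)
  rw [(chartAt E (1 : G)).right_inv hx] at h
  rw [fieldInChart, leftInvField, hG.tmap_mul_left hx, h]

/-- By Schwarz's theorem, right translations produce the same mixed derivative, with the two
arguments exchanged. -/
theorem IsLieGroup.hasDirDeriv_right_translation (hG : IsLieGroup E G) (z v : E) :
    HasDirDeriv (fun x => dirDeriv (chartMul (chartAt E (1 : G))) (chartAt E (1 : G) 1, x) (v, 0))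
      (chartAt E (1 : G) 1) z (mixedDeriv G v z) := by
  have h := (((hG.smoothOn_chartMul (chart_mem_atlas E 1)).dirDeriv (hG.isOpen_chartMulDomain _)
    (v, 0)).hasDirDeriv (hG.isOpen_chartMulDomain _)
    (mem_chartMulDomain_right (mem_chart_target E 1)) (0, z)).right
  rwa [(hG.smoothOn_chartMul (chart_mem_atlas E 1)).dirDeriv_comm (hG.isOpen_chartMulDomain _)
    (mem_chartMulDomain_right (mem_chart_target E 1))] at h

theorem IsLieGroup.bracket_eq (hG : IsLieGroup E G) (v w : E) :
    bracket E G v w = mixedDeriv G v w - mixedDeriv G w v := by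
  have key : ∀ v w : E, dirDeriv (fieldInChart E (leftInvField E (G := G) w) (chartAt E (1 : G)))
      (chartAt E (1 : G) 1) v = mixedDeriv G v w := by
    intro v w
    refine ((hG.hasDirDeriv_left_translation v w).congr_of_eventuallyEq ?_).dirDeriv_eq
    filter_upwards [(chartAt E (1 : G)).open_target.mem_nhds (mem_chart_target E 1)] with x hx
    exact (hG.fieldInChart_leftInvField hx w).symm
  rw [bracket, fieldBracket, hG.fieldInChart_leftInvField (mem_chart_target E 1),
    hG.fieldInChart_leftInvField (mem_chart_target E 1), hG.dirDeriv_chartMul_right,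
    hG.dirDeriv_chartMul_right, key, key]

end Group

/-! ### Bi-invariant forms at the identity -/

section Forms

/-- A function of three arguments that is antisymmetric in the first two and symmetric in the last
two vanishes: the braid relation `(12)(23)(12) = (23)(12)(23)` gives it both signs. -/
theorem eq_zero_of_antisymm_of_symm {α : Type*} {f : α → α → α → ℝ}
    (h1 : ∀ x y z, f x y z = -f y x z) (h2 : ∀ x y z, f x y z = f x z y) (x y z : α) :
    f x y z = 0 := by
  linarith [h1 x y z, h2 y x z, h1 y z x, h2 z y x, h1 z x y, h2 x z y]

variable {E : Type*} [AddCommGroup E] [Module ℝ E]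

theorem alternatingMap_pair_swap (b : E [⋀^Fin 2]→ₗ[ℝ] ℝ) (x y : E) :
    b ![x, y] = -b ![y, x] := by
  have h := b.map_swap ![y, x] (i := 0) (j := 1) (by decide)
  rw [← h]
  congr 1
  funext i
  fin_cases i <;> rfl

/-- An alternating bilinear form, differentiated along a line. -/
theorem hasDirDeriv_alternatingMap_pair (b : E [⋀^Fin 2]→ₗ[ℝ] ℝ) (v a : Fin 2 → E) :
    HasDirDeriv b v a (b ![a 0, v 1] + b ![v 0, a 1]) := by
  have hexp : ∀ t : ℝ, b (v + t • a) = b v + t * (b ![a 0, v 1] + b ![v 0, a 1])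
      + t * t * b ![a 0, a 1] := by
    intro t
    have e1 : v + t • a = ![v 0 + t • a 0, v 1 + t • a 1] := by
      funext i
      fin_cases i <;> rfl
    have e2 : v = ![v 0, v 1] := by
      funext i
      fin_cases i <;> rfl
    have add1 : ∀ x y z : E, b ![x + t • y, z] = b ![x, z] + t * b ![y, z] := by
      intro x y z
      have h := b.map_vecCons_add ![z] x (t • y)
      have h' := b.map_vecCons_smul ![z] t y
      rw [h, h', smul_eq_mul]
    have add2 : ∀ x y z : E, b ![z, x + t • y] = b ![z, x] + t * b ![z, y] := by
      intro x y z
      rw [alternatingMap_pair_swap, add1, alternatingMap_pair_swap b z x,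
        alternatingMap_pair_swap b z y]
      ring
    rw [e1, add1, add2, add2]
    conv_rhs => rw [e2]
    simp only [Matrix.cons_val_zero, Matrix.cons_val_one]
    ring
  have hlim : Tendsto (fun t : ℝ => b ![a 0, v 1] + b ![v 0, a 1] + t * b ![a 0, a 1]) (𝓝[≠] 0)
      (𝓝 (b ![a 0, v 1] + b ![v 0, a 1])) := by
    have : Continuous fun t : ℝ => b ![a 0, v 1] + b ![v 0, a 1] + t * b ![a 0, a 1] := by
      fun_prop
    simpa using (this.tendsto 0).mono_left nhdsWithin_le_nhds
  refine hlim.congr' ?_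
  filter_upwards [self_mem_nhdsWithin] with t ht
  have ht : t ≠ 0 := ht
  rw [hexp, smul_eq_mul]
  field_simp
  ring

variable [TopologicalSpace E] {G : Type*} [Group G] [TopologicalSpace G] [ChartedSpace E G]

/-- The local representative of a differential form in the preferred chart at the identity. -/
noncomputable def DiffForm.atOne {k : ℕ} (ω : DiffForm E G k) (p : E × (Fin k → E)) : ℝ :=
  ω.toFun ((chartAt E (1 : G)).symm p.1) fun i => tchartSymm E (chartAt E (1 : G)) p.1 (p.2 i)

variable [IsTopologicalAddGroup E] [ContinuousSMul ℝ E] [T2Space E]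

theorem DiffForm.atOne_one {k : ℕ} (ω : DiffForm E G k) (v : Fin k → E) :
    ω.atOne (chartAt E (1 : G) 1, v) = ω.toFun 1 v := by
  have h : ∀ w : E, tchartSymm E (chartAt E (1 : G)) (chartAt E (1 : G) 1) w = w := fun w => by
    refine dirDeriv_eq_of_eventually_eq ?_ w
    simpa using (chartAt E (1 : G)).eventually_right_inverse (mem_chart_target E 1)
  simp [atOne, h]

theorem DiffForm.continuous_toFun_one {k : ℕ} (ω : DiffForm E G k) :
    Continuous (ω.toFun 1) := by
  have hc : Continuous fun v : Fin k → E => (chartAt E (1 : G) 1, v) := by fun_prop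
  have h := (ω.smooth _ (chart_mem_atlas E 1)).continuousOn.comp_continuous hc
    fun v => ⟨mem_chart_target E 1, trivial⟩
  exact h.congr fun v => ω.atOne_one v

/-- If a 2-form has constant value on a moving frame pair `A x`, differentiating along `z` gives
the Leibniz rule. The term in which the form itself is differentiated depends only on `z` and on
the value of the frame at the identity. -/
theorem DiffForm.dirDeriv_atOne_add (ω : DiffForm E G 2) {A : E → Fin 2 → E} {z : E}
    {v a : Fin 2 → E} (hA : A (chartAt E (1 : G) 1) = v)
    (ha : ∀ i, HasDirDeriv (fun x => A x i) (chartAt E (1 : G) 1) z (a i))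
    (hconst : ∀ x ∈ (chartAt E (1 : G)).target, ω.atOne (x, A x) = ω.toFun 1 v) :
    dirDeriv ω.atOne (chartAt E (1 : G) 1, v) (z, 0) +
      (ω.toFun 1 ![a 0, v 1] + ω.toFun 1 ![v 0, a 1]) = 0 := by
  set x₀ := chartAt E (1 : G) 1
  have hU : IsOpen ((chartAt E (1 : G)).target ×ˢ (Set.univ : Set (Fin 2 → E))) :=
    (chartAt E (1 : G)).open_target.prod isOpen_univ
  have hs : SmoothOn ω.atOne ((chartAt E (1 : G)).target ×ˢ (Set.univ : Set (Fin 2 → E))) :=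
    ω.smooth _ (chart_mem_atlas E 1)
  have hx₀ : (x₀, v) ∈ (chartAt E (1 : G)).target ×ˢ (Set.univ : Set (Fin 2 → E)) :=
    ⟨mem_chart_target E 1, trivial⟩
  have hfib : dirDeriv ω.atOne (x₀, v) (0, a) = ω.toFun 1 ![a 0, v 1] + ω.toFun 1 ![v 0, a 1] := by
    refine HasDirDeriv.dirDeriv_eq
      ((hasDirDeriv_alternatingMap_pair (ω.toFun 1) v a).congr fun t => ?_)
    rw [← ω.atOne_one, ← ω.atOne_one]
    simp [x₀]
  have hcurve : dirDeriv ω.atOne (x₀, v) (z, a) = 0 := by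
    have hx : Tendsto (fun t : ℝ => x₀ + t • z) (𝓝[≠] 0) (𝓝 x₀) := by
      have : Continuous fun t : ℝ => x₀ + t • z := by fun_prop
      simpa using (this.tendsto 0).mono_left nhdsWithin_le_nhds
    have hd : Tendsto (fun t : ℝ => t⁻¹ • ((x₀ + t • z, A (x₀ + t • z)) -
        (x₀ + (0 : ℝ) • z, A (x₀ + (0 : ℝ) • z)))) (𝓝[≠] 0) (𝓝 (z, a)) := by
      refine Tendsto.prodMk_nhds ?_ (tendsto_pi_nhds.2 fun i => ?_)
      · refine tendsto_const_nhds.congr' ?_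
        filter_upwards [self_mem_nhdsWithin] with t ht
        simp [inv_smul_smul₀ (show t ≠ 0 from ht)]
      · simpa [HasDirDeriv] using ha i
    have h := hs.tendsto_comp_curve hU (c := fun t : ℝ => (x₀ + t • z, A (x₀ + t • z)))
      (by simpa [hA] using hx₀) hd
    simp only [zero_smul, add_zero, hA] at h
    refine tendsto_nhds_unique h (tendsto_const_nhds.congr' ?_)
    filter_upwards [hx.eventually ((chartAt E (1 : G)).open_target.mem_nhds
      (mem_chart_target E 1))] with t ht
    rw [hconst _ ht, ω.atOne_one, sub_self, smul_zero]
  -- Only additivity is needed to separate the direction `z` from the variation of the frame.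
  rw [← hfib, ← hs.dirDeriv_add hU hx₀, ← hcurve]
  simp

variable [LocallyConvexSpace ℝ E]

/-- The value at the identity of a bi-invariant 2-form is invariant under the adjoint
representation of the Lie algebra: compare the derivatives of the form along the left invariant
and along the right invariant frames. -/
theorem DiffForm.BiInvariant.bracket_add_bracket (hG : IsLieGroup E G) {ω : DiffForm E G 2}
    (hω : DiffForm.BiInvariant E ω) (z v w : E) :
    ω.toFun 1 ![bracket E G z v, w] + ω.toFun 1 ![v, bracket E G z w] = 0 := by
  have hl := ω.dirDeriv_atOne_add (z := z) (v := ![v, w])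
    (A := fun x i => dirDeriv (chartMul (chartAt E (1 : G))) (x, chartAt E (1 : G) 1)
      (0, ![v, w] i))
    (funext fun i => hG.dirDeriv_chartMul_right _)
    (fun i => hG.hasDirDeriv_left_translation z _) (fun x hx => by
      rw [← (hω ((chartAt E (1 : G)).symm x) 1 ![v, w]).1]
      simp only [hG.tmap_mul_left hx, mul_one]
      rfl)
  have hr := ω.dirDeriv_atOne_add (z := z) (v := ![v, w])
    (A := fun x i => dirDeriv (chartMul (chartAt E (1 : G))) (chartAt E (1 : G) 1, x)
      (![v, w] i, 0))
    (funext fun i => hG.dirDeriv_chartMul_left _)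
    (fun i => hG.hasDirDeriv_right_translation z _) (fun x hx => by
      rw [← (hω ((chartAt E (1 : G)).symm x) 1 ![v, w]).2]
      simp only [hG.tmap_mul_right hx, one_mul]
      rfl)
  have sub1 : ∀ x y u : E, ω.toFun 1 ![x - y, u] = ω.toFun 1 ![x, u] - ω.toFun 1 ![y, u] := by
    intro x y u
    have h := (ω.toFun 1).map_vecCons_add ![u] (x - y) y
    rw [sub_add_cancel] at h
    linarith
  have sub2 : ∀ x y u : E, ω.toFun 1 ![u, x - y] = ω.toFun 1 ![u, x] - ω.toFun 1 ![u, y] := by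
    intro x y u
    rw [alternatingMap_pair_swap, sub1, alternatingMap_pair_swap _ u x,
      alternatingMap_pair_swap _ u y]
    ring
  simp only [Matrix.cons_val_zero, Matrix.cons_val_one] at hl hr
  rw [hG.bracket_eq, hG.bracket_eq, sub1, sub2]
  linarith

theorem DiffForm.BiInvariant.toFun_one_bracket (hG : IsLieGroup E G) {ω : DiffForm E G 2}
    (hω : DiffForm.BiInvariant E ω) (z v w : E) : ω.toFun 1 ![bracket E G z v, w] = 0 := by
  refine eq_zero_of_antisymm_of_symm (f := fun z v w => ω.toFun 1 ![bracket E G z v, w])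
    (fun x y u => ?_) (fun x y u => ?_) z v w
  · have h := (ω.toFun 1).map_vecCons_smul ![u] (-1) (bracket E G y x)
    -- The bracket is antisymmetric by its very formula.
    have hb : bracket E G x y = (-1 : ℝ) • bracket E G y x := by
      simp [bracket, fieldBracket]
    simp only [hb]
    rw [h, smul_eq_mul, neg_one_mul]
  · have h := hω.bracket_add_bracket hG x y u
    rw [alternatingMap_pair_swap _ y] at h
    linarith

end Forms

end LCLie

theorem mainTheorem6
    {E : Type*} [AddCommGroup E] [Module ℝ E] [TopologicalSpace E]
    [IsTopologicalAddGroup E] [ContinuousSMul ℝ E] [LocallyConvexSpace ℝ E] [T2Space E]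
    {G : Type*} [Group G] [TopologicalSpace G] [T2Space G] [ConnectedSpace G] [ChartedSpace E G]
    (hG : LCLie.IsLieGroup E G)
    (hreg : LCLie.MilnorRegular E G)
    (hperf : LCLie.TopologicallyPerfect E G)
    (ω : LCLie.DiffForm E G 2) (hω : LCLie.DiffForm.BiInvariant E ω) :
    ∀ g : G, ω.toFun g = 0 := by
  have hbr : ∀ u w : E, ω.toFun 1 ![u, w] = 0 := by
    intro u w
    have hc : Continuous fun u : E => ω.toFun 1 ![u, w] :=
      ω.continuous_toFun_one.comp (by fun_prop)
    have hspan : ∀ u ∈ Submodule.span ℝ {u : E | ∃ v w : E, u = LCLie.bracket E G v w},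
        ω.toFun 1 ![u, w] = 0 := by
      intro u hu
      induction hu using Submodule.span_induction with
      | mem u hu =>
        obtain ⟨v, z, rfl⟩ := hu
        exact hω.toFun_one_bracket hG v z w
      | zero => simpa using (ω.toFun 1).map_vecCons_smul ![w] 0 0
      | add x y _ _ hx hy => rw [(ω.toFun 1).map_vecCons_add ![w] x y, hx, hy, add_zero]
      | smul r x _ hx => rw [(ω.toFun 1).map_vecCons_smul ![w] r x, hx, smul_zero]
    have hu : u ∈ closure (Submodule.span ℝ {u : E | ∃ v w : E, u = LCLie.bracket E G v w} :
        Set E) := hperf ▸ Set.mem_univ u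
    exact closure_minimal hspan (isClosed_eq hc continuous_const) hu
  intro g
  ext v
  -- Left translation by `g⁻¹` moves the form at `g` to the identity.
  rw [← (hω g⁻¹ g v).1, inv_mul_cancel]
  have h := hbr (LCLie.tmap E E (fun y : G => g⁻¹ * y) g (v 0))
    (LCLie.tmap E E (fun y : G => g⁻¹ * y) g (v 1))
  rw [AlternatingMap.zero_apply, ← h]
  congr 1
  funext i
  fin_cases i <;> rfl
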